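/- Let $\mu$ be a probability measure on $\mathbb{R}$ and $\rho>1$. Denote by $F(x)=\mu((-\infty,x])$ its cumulative distribution function, by $F^{-1}(u)=\inf\{x\in\mathbb{R}:F(x)\ge u\}$, $u\in(0,1)$, its quantile function, and set $F^{-1}(0+)=\lim_{u\to0+}F^{-1}(u)\in[-\infty,+\infty)$ and $F^{-1}(1)=\lim_{u\to1-}F^{-1}(u)\in(-\infty,+\infty]$. For $N\ge1$ let $$e_N(\mu,\rho)=\inf\Big\{\mathcal W_\rho\Big(\frac1N\sum_{i=1}^N\delta_{x_i},\mu\Big):-\infty<x_1\le x_2\le\cdots\le x_N<+\infty\Big\}\in[0,+\infty],$$ where $\mathcal W_\rho(\nu,\eta)=\Big(\inf_\pi\int_{\mathbb{R}\times\mathbb{R}}|x-y|^\rho\,\pi(dx,dy)\Big)^{1/\rho}$, the infimum being taken over all couplings $\pi$ of $\nu$ and $\eta$, is the Wasserstein distance with index $\rho$. If there exists $\alpha>\frac1\rho$ such that $\sup_{N\ge1}N^\alpha e_N(\mu,\rho)<+\infty$, then $\mu$ is compactly supported, that is, $F^{-1}(1)-F^{-1}(0+)<+\infty$. -/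

import Mathlib

open MeasureTheory Set Filter Topology
open scoped ENNReal

namespace DetQuant

noncomputable section

/-- The set of couplings of `ν` and `η`: measures on `ℝ × ℝ` with marginals `ν` and `η`. -/
def couplings (ν η : Measure ℝ) : Set (Measure (ℝ × ℝ)) :=
  {π | π.map Prod.fst = ν ∧ π.map Prod.snd = η}

/-- The Wasserstein distance with index `ρ` on the real line, with values in `[0, ∞]`:
`(inf_π ∫ |x - y| ^ ρ π(dx, dy)) ^ (1 / ρ)`, the infimum being over all couplings `π`. -/
def wasserstein (ρ : ℝ) (ν η : Measure ℝ) : ℝ≥0∞ :=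
  (⨅ π ∈ couplings ν η, ∫⁻ p, ENNReal.ofReal (|p.1 - p.2| ^ ρ) ∂π) ^ (1 / ρ)

/-- The empirical measure `(1 / N) ∑ i, δ_{x i}` of `N` points. -/
def empirical {N : ℕ} (x : Fin N → ℝ) : Measure ℝ :=
  (N : ℝ≥0∞)⁻¹ • ∑ i, Measure.dirac (x i)

/-- `e_N(μ, ρ)`: the infimum of the Wasserstein distance with index `ρ` between `μ` and the
empirical measure of `N` points `x_1 ≤ ... ≤ x_N`. -/
def minError (N : ℕ) (μ : Measure ℝ) (ρ : ℝ) : ℝ≥0∞ :=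
  ⨅ (x : Fin N → ℝ) (_ : Monotone x), wasserstein ρ (empirical x) μ

/-- The quantile function `F⁻¹(u) = inf {x : ℝ | u ≤ F(x)}`, where `F(x) = μ((-∞, x])`,
meant for `u ∈ (0, 1)`. -/
def quantile (μ : Measure ℝ) (u : ℝ) : ℝ :=
  sInf {x : ℝ | u ≤ μ.real (Iic x)}

/-- `F⁻¹(0+)`, the right-hand limit of the quantile function at `0`, in `[-∞, ∞]`. -/
def quantileZeroPlus (μ : Measure ℝ) : EReal :=
  Function.rightLim (fun u : ℝ => (quantile μ u : EReal)) 0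

/-- `F⁻¹(1)`, the left-hand limit of the quantile function at `1`, in `[-∞, ∞]`. -/
def quantileOne (μ : Measure ℝ) : EReal :=
  Function.leftLim (fun u : ℝ => (quantile μ u : EReal)) 1

theorem quantile_monotoneOn (μ : Measure ℝ) [IsProbabilityMeasure μ] :
    MonotoneOn (fun u : ℝ => (quantile μ u : EReal)) (Ioo 0 1) := by
  intro u hu v hv huv
  simp only [EReal.coe_le_coe_iff]
  refine csInf_le_csInf ?_ ?_ fun x hx => huv.trans hx
  · have h := ProbabilityTheory.tendsto_cdf_atBot μ
    obtain ⟨a, ha⟩ := (h.eventually_lt_const hu.1).exists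
    refine ⟨a, fun x hx => ?_⟩
    by_contra hlt
    have h1 := (ProbabilityTheory.cdf μ).mono (not_le.1 hlt).le
    rw [ProbabilityTheory.cdf_eq_real] at h1
    exact absurd ha (not_lt.2 (hx.trans h1))
  · have h := ProbabilityTheory.tendsto_cdf_atTop μ
    obtain ⟨b, hb⟩ := (h.eventually_const_lt hv.2).exists
    refine ⟨b, ?_⟩
    rw [ProbabilityTheory.cdf_eq_real] at hb
    exact hb.le

/-- The limit that defines `F⁻¹(0+)` exists. -/
theorem tendsto_quantileZeroPlus (μ : Measure ℝ) [IsProbabilityMeasure μ] :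
    Tendsto (fun u : ℝ => (quantile μ u : EReal)) (𝓝[>] 0) (𝓝 (quantileZeroPlus μ)) := by
  have h := (quantile_monotoneOn μ).tendsto_nhdsWithin_Ioo_right ⟨1 / 2, by norm_num, by norm_num⟩
    (OrderBot.bddBelow _)
  have e : quantileZeroPlus μ = _ := rightLim_eq_of_tendsto h
  rwa [e]

/-- The limit that defines `F⁻¹(1)` exists. -/
theorem tendsto_quantileOne (μ : Measure ℝ) [IsProbabilityMeasure μ] :
    Tendsto (fun u : ℝ => (quantile μ u : EReal)) (𝓝[<] 1) (𝓝 (quantileOne μ)) := by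
  have h := (quantile_monotoneOn μ).tendsto_nhdsWithin_Ioo_left ⟨1 / 2, by norm_num, by norm_num⟩
    (OrderTop.bddAbove _)
  have e : quantileOne μ = _ := leftLim_eq_of_tendsto h
  rwa [e]

end

end DetQuant

namespace DetQuant

/-! Take `N = 2 ^ k` points `x k` with transport cost at most `K * q ^ k`; the assumption `α > 1 /
ρ` says exactly that `q = 2 ^ (-(α * ρ))` satisfies `2 * q < 1`. An atom of `x (k + 1)` has mass `2
^ (-(k + 1))`, too much to be moved far at that cost. If one lay beyond `‖x k‖ + 2 * t` (sup norm),
its mass would either travel at least `t` or land where `μ` lives at distance `t` from the ball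
holding `x k`; Markov's inequality bounds both masses (`empirical_le_add`, `measure_norm_add_le`).
So the radii grow by increments of order `(2 * q) ^ (k / ρ)`, which are summable. All `x k` lie in
one ball, and letting `k → ∞` shows that `μ` has no mass well outside it. -/

/-- Markov's inequality for the transport cost. -/
theorem measure_le_abs_sub_le {π : Measure (ℝ × ℝ)} {ρ c t : ℝ} (hρ : 0 < ρ) (ht : 0 < t)
    (hc : ∫⁻ p, ENNReal.ofReal (|p.1 - p.2| ^ ρ) ∂π ≤ ENNReal.ofReal c) :
    π {p | t ≤ |p.1 - p.2|} ≤ ENNReal.ofReal (c / t ^ ρ) := by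
  have htρ : 0 < t ^ ρ := Real.rpow_pos_of_pos ht ρ
  have hm : Measurable fun p : ℝ × ℝ => ENNReal.ofReal (|p.1 - p.2| ^ ρ) := by fun_prop
  have h := mul_meas_ge_le_lintegral₀ (μ := π) hm.aemeasurable (ENNReal.ofReal (t ^ ρ))
  rw [ENNReal.ofReal_div_of_pos htρ, ENNReal.le_div_iff_mul_le
    (Or.inl (by simpa using htρ)) (Or.inl ENNReal.ofReal_ne_top), mul_comm]
  refine (mul_le_mul_right ?_ _).trans (h.trans hc)
  refine measure_mono fun p hp => ENNReal.ofReal_le_ofReal ?_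
  exact Real.rpow_le_rpow ht.le hp hρ.le

theorem empirical_apply_norm_lt {N : ℕ} (x : Fin N → ℝ) :
    empirical x {y | ‖x‖ < |y|} = 0 := by
  have hm : MeasurableSet {y : ℝ | ‖x‖ < |y|} := measurableSet_lt (by fun_prop) (by fun_prop)
  simp only [empirical, Measure.smul_apply, Measure.finsetSum_apply, smul_eq_mul]
  rw [Finset.sum_eq_zero, mul_zero]
  intro i _
  rw [Measure.dirac_apply' _ hm]
  have := norm_le_pi_norm x i
  simpa using this

theorem inv_le_empirical_of_le_norm {N : ℕ} (x : Fin N → ℝ) {a : ℝ} (ha : 0 < a)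
    (h : a ≤ ‖x‖) : (N : ℝ≥0∞)⁻¹ ≤ empirical x {y | a ≤ |y|} := by
  have hm : MeasurableSet {y : ℝ | a ≤ |y|} := measurableSet_le (by fun_prop) (by fun_prop)
  obtain ⟨i, hi⟩ : ∃ i, a ≤ |x i| := by
    by_contra! hlt
    exact absurd h (not_le.2 ((pi_norm_lt_iff ha).2 hlt))
  simp only [empirical, Measure.smul_apply, Measure.finsetSum_apply, smul_eq_mul]
  refine le_mul_of_one_le_right' ?_
  refine le_trans ?_ (Finset.single_le_sum (fun _ _ => zero_le) (Finset.mem_univ i))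
  rw [Measure.dirac_apply' _ hm]
  simp [hi]

/-- The mass that `μ` puts at distance `t` outside the ball containing the points is bounded by
the mass that is transported over a distance at least `t`. -/
theorem measure_norm_add_le {N : ℕ} {x : Fin N → ℝ} {μ : Measure ℝ} {π : Measure (ℝ × ℝ)}
    (hπ : π ∈ couplings (empirical x) μ) (t : ℝ) :
    μ {y | ‖x‖ + t ≤ |y|} ≤ π {p | t ≤ |p.1 - p.2|} := by
  have hm : MeasurableSet {y : ℝ | ‖x‖ < |y|} := measurableSet_lt (by fun_prop) (by fun_prop)
  have hm' : MeasurableSet {y : ℝ | ‖x‖ + t ≤ |y|} := measurableSet_le (by fun_prop) (by fun_prop)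
  have h0 := empirical_apply_norm_lt x
  rw [← hπ.1, Measure.map_apply measurable_fst hm] at h0
  rw [← hπ.2, Measure.map_apply measurable_snd hm']
  refine measure_mono_ae ?_
  filter_upwards [measure_eq_zero_iff_ae_notMem.1 h0] with p hp hp'
  simp only [mem_preimage, mem_ofPred_eq, not_lt] at hp
  change ‖x‖ + t ≤ |p.2| at hp'
  change t ≤ |p.1 - p.2|
  have := abs_sub_abs_le_abs_sub p.2 p.1
  rw [abs_sub_comm] at this
  linarith

/-- Triangle inequality: mass starting beyond radius `a + t` either ends beyond radius `a` or moves
at least `t`. -/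
theorem empirical_le_add {ν μ : Measure ℝ} {π : Measure (ℝ × ℝ)}
    (hπ : π ∈ couplings ν μ) (a t : ℝ) :
    ν {y | a + t ≤ |y|} ≤ μ {y | a ≤ |y|} + π {p | t ≤ |p.1 - p.2|} := by
  have hm : MeasurableSet {y : ℝ | a + t ≤ |y|} := measurableSet_le (by fun_prop) (by fun_prop)
  have hm' : MeasurableSet {y : ℝ | a ≤ |y|} := measurableSet_le (by fun_prop) (by fun_prop)
  rw [← hπ.1, Measure.map_apply measurable_fst hm, ← hπ.2, Measure.map_apply measurable_snd hm']
  refine (measure_mono fun p hp => ?_).trans (measure_union_le _ _)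
  change a + t ≤ |p.1| at hp
  by_cases h : a ≤ |p.2|
  · exact Or.inl h
  · refine Or.inr ?_
    change t ≤ |p.1 - p.2|
    have := abs_sub_abs_le_abs_sub p.1 p.2
    linarith

theorem exists_coupling_of_minError_lt {N : ℕ} {μ : Measure ℝ} {ρ : ℝ} (hρ : 0 < ρ) {b : ℝ≥0∞}
    (h : minError N μ ρ < b) :
    ∃ x : Fin N → ℝ, ∃ π ∈ couplings (empirical x) μ,
      ∫⁻ p, ENNReal.ofReal (|p.1 - p.2| ^ ρ) ∂π < b ^ ρ := by
  simp only [minError, iInf_lt_iff] at h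
  obtain ⟨x, -, h⟩ := h
  refine ⟨x, ?_⟩
  rw [wasserstein, one_div, ENNReal.rpow_inv_lt_iff hρ] at h
  simpa only [iInf_lt_iff, exists_prop] using h

/-- Along the powers of two the transport cost decays geometrically, with ratio below `1 / 2`. -/
theorem exists_dyadic_cost_bound {μ : Measure ℝ} {ρ : ℝ} (hρ : 0 < ρ)
    (h : ∃ α : ℝ, 1 / ρ < α ∧
      (⨆ (N : ℕ) (_ : 1 ≤ N), (N : ℝ≥0∞) ^ α * minError N μ ρ) < ∞) :
    ∃ K q : ℝ, 0 < K ∧ 0 < q ∧ 2 * q < 1 ∧ ∀ k : ℕ, ∃ x : Fin (2 ^ k) → ℝ,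
      ∃ π ∈ couplings (empirical x) μ,
        ∫⁻ p, ENNReal.ofReal (|p.1 - p.2| ^ ρ) ∂π ≤ ENNReal.ofReal (K * q ^ k) := by
  obtain ⟨α, hα, hS⟩ := h
  set S := ⨆ (N : ℕ) (_ : 1 ≤ N), (N : ℝ≥0∞) ^ α * minError N μ ρ with hSdef
  -- The extra 1 makes the bound strict, so a coupling below it exists without the infima being
  -- attained.
  set C : ℝ := S.toReal + 1
  have hC : 0 < C := by positivity
  have hβ : 1 < α * ρ := by rwa [div_lt_iff₀ hρ] at hα
  refine ⟨C ^ ρ, (2 : ℝ) ^ (-(α * ρ)), by positivity, by positivity, ?_, fun k => ?_⟩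
  · have : (2 : ℝ) * 2 ^ (-(α * ρ)) = 2 ^ (1 + -(α * ρ)) := by
      rw [Real.rpow_add two_pos, Real.rpow_one]
    rw [this]
    exact Real.rpow_lt_one_of_one_lt_of_neg one_lt_two (by linarith)
  · have hpos : (0 : ℝ) < ((2 : ℝ) ^ k) ^ α := by positivity
    have hcast : (((2 ^ k : ℕ) : ℝ≥0∞)) ^ α = ENNReal.ofReal (((2 : ℝ) ^ k) ^ α) := by
      rw [← ENNReal.ofReal_rpow_of_pos (by positivity), ENNReal.ofReal_pow two_pos.le]
      simp
    have hle : (((2 ^ k : ℕ) : ℝ≥0∞)) ^ α * minError (2 ^ k) μ ρ ≤ S :=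
      le_iSup₂ (f := fun (N : ℕ) (_ : 1 ≤ N) => (N : ℝ≥0∞) ^ α * minError N μ ρ) (2 ^ k)
        Nat.one_le_two_pow
    have hlt : S < ENNReal.ofReal C := by
      rw [ENNReal.lt_ofReal_iff_toReal_lt hS.ne]
      exact lt_add_one _
    have hmin : minError (2 ^ k) μ ρ < ENNReal.ofReal (C / ((2 : ℝ) ^ k) ^ α) := by
      rw [ENNReal.ofReal_div_of_pos hpos, ENNReal.lt_div_iff_mul_lt
        (Or.inl (by simpa using hpos)) (Or.inl ENNReal.ofReal_ne_top), mul_comm, ← hcast]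
      exact hle.trans_lt hlt
    obtain ⟨x, π, hπ, hcost⟩ := exists_coupling_of_minError_lt hρ hmin
    refine ⟨x, π, hπ, hcost.le.trans_eq ?_⟩
    rw [ENNReal.ofReal_rpow_of_pos (by positivity), Real.div_rpow hC.le hpos.le,
      ← Real.rpow_mul (by positivity), div_eq_mul_inv, ← Real.rpow_neg (by positivity),
      ← Real.rpow_natCast, ← Real.rpow_mul two_pos.le, ← Real.rpow_natCast,
      ← Real.rpow_mul two_pos.le, mul_comm (k : ℝ)]

theorem exists_measure_lt_abs_eq_zero {μ : Measure ℝ} [IsProbabilityMeasure μ] {ρ : ℝ}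
    (hρ : 0 < ρ)
    (h : ∃ α : ℝ, 1 / ρ < α ∧
      (⨆ (N : ℕ) (_ : 1 ≤ N), (N : ℝ≥0∞) ^ α * minError N μ ρ) < ∞) :
    ∃ R : ℝ, μ {y | R < |y|} = 0 := by
  obtain ⟨K, q, hK, hq, h2q, hx⟩ := exists_dyadic_cost_bound hρ h
  choose x π hπ hcost using hx
  have htail (k : ℕ) {t : ℝ} (ht : 0 < t) :
      μ {y | ‖x k‖ + t ≤ |y|} ≤ ENNReal.ofReal (K * q ^ k / t ^ ρ) :=
    (measure_norm_add_le (hπ k) t).trans (measure_le_abs_sub_le hρ ht (hcost k))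
  set s : ℝ := (2 * q) ^ (1 / ρ) with hs
  have hs0 : 0 < s := by positivity
  have hs1 : s < 1 := Real.rpow_lt_one (by positivity) h2q (by positivity)
  have hsρ : s ^ ρ = 2 * q := by
    rw [hs, ← Real.rpow_mul (by positivity), one_div_mul_cancel hρ.ne', Real.rpow_one]
  -- The factor 5 leaves room: with `t = D * s ^ k`, the two Markov bounds sum to `(2 + 2 * q) / 5 <
  -- 3 / 5` of one atom's mass.
  set D : ℝ := (5 * K) ^ (1 / ρ) with hD
  have hD0 : 0 < D := by positivity
  have hDρ : D ^ ρ = 5 * K := by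
    rw [hD, ← Real.rpow_mul (by positivity), one_div_mul_cancel hρ.ne', Real.rpow_one]
  have hstep (k : ℕ) : ‖x (k + 1)‖ ≤ ‖x k‖ + 2 * (D * s ^ k) := by
    by_contra! hlt
    have ht : 0 < D * s ^ k := by positivity
    set t := D * s ^ k with htdef
    have htρ : t ^ ρ = 5 * K * (2 * q) ^ k := by
      rw [htdef, Real.mul_rpow hD0.le (by positivity), hDρ, ← Real.rpow_natCast,
        ← Real.rpow_mul hs0.le, mul_comm (k : ℝ), Real.rpow_mul hs0.le, hsρ, Real.rpow_natCast]
    -- Two couplings are chained: level `k + 1` carries the far atom to `μ`, level `k` bounds the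
    -- tail of `μ`.
    have h1 := (inv_le_empirical_of_le_norm (x (k + 1)) (a := ‖x k‖ + t + t) (by positivity)
      (by linarith)).trans ((empirical_le_add (hπ (k + 1)) _ t).trans
        (add_le_add (htail k ht) (measure_le_abs_sub_le hρ ht (hcost (k + 1)))))
    rw [← ENNReal.ofReal_add (by positivity) (by positivity), htρ] at h1
    have hN : (((2 ^ (k + 1) : ℕ) : ℝ≥0∞))⁻¹ = ENNReal.ofReal (((2 : ℝ) ^ (k + 1))⁻¹) := by
      rw [ENNReal.ofReal_inv_of_pos (by positivity), ENNReal.ofReal_pow two_pos.le]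
      simp
    rw [hN, ENNReal.ofReal_le_ofReal_iff (by positivity), mul_pow] at h1
    have e : K * q ^ k / (5 * K * (2 ^ k * q ^ k)) + K * q ^ (k + 1) / (5 * K * (2 ^ k * q ^ k))
        = (2 + 2 * q) / 5 * ((2 : ℝ) ^ (k + 1))⁻¹ := by
      field_simp
      ring
    rw [e] at h1
    have : (0 : ℝ) < ((2 : ℝ) ^ (k + 1))⁻¹ := by positivity
    nlinarith
  set R : ℝ := ‖x 0‖ + 2 * D / (1 - s) with hR
  -- Closed form of the geometric sum of the increments.
  have hbound (k : ℕ) : ‖x k‖ ≤ ‖x 0‖ + 2 * D / (1 - s) * (1 - s ^ k) := by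
    induction k with
    | zero => simp
    | succ k ih =>
      refine (hstep k).trans ((add_le_add_left ih _).trans_eq ?_)
      have : 1 - s ≠ 0 := by linarith
      field_simp
      ring
  have hxR (k : ℕ) : ‖x k‖ ≤ R := by
    refine (hbound k).trans ?_
    have h1 : 0 ≤ 2 * D / (1 - s) := div_nonneg (by positivity) (by linarith)
    have h2 : 0 < s ^ k := by positivity
    rw [hR]
    nlinarith
  -- At fixed distance 1 from the common ball, the tail bound `K * q ^ k` holds for every `k` and
  -- tends to 0.
  refine ⟨R + 1, le_antisymm (ge_of_tendsto' (x := atTop)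
    (f := fun k : ℕ => ENNReal.ofReal (K * q ^ k)) ?_ fun k => ?_) zero_le⟩
  · have hq0 := (tendsto_pow_atTop_nhds_zero_of_lt_one hq.le (by linarith)).const_mul K
    rw [mul_zero] at hq0
    simpa using ENNReal.tendsto_ofReal hq0
  · have h1 := htail k one_pos
    rw [Real.one_rpow, div_one] at h1
    refine (measure_mono fun y hy => ?_).trans h1
    change R + 1 < |y| at hy
    change ‖x k‖ + 1 ≤ |y|
    linarith [hxR k]

/-- The distribution function vanishes below `-R`, so `0 < u` excludes those points from the set
defining the quantile; it equals 1 at `R`, so `R` belongs to that set. -/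
theorem quantile_mem_Icc {μ : Measure ℝ} [IsProbabilityMeasure μ] {R : ℝ}
    (hR : μ {y | R < |y|} = 0) {u : ℝ} (hu : u ∈ Ioo 0 1) : quantile μ u ∈ Icc (-R) R := by
  have hlow : ∀ y ∈ {y : ℝ | u ≤ μ.real (Iic y)}, -R ≤ y := by
    intro y hy
    by_contra! hlt
    have h0 : μ (Iic y) = 0 := measure_mono_null (fun z (hz : z ≤ y) => by
      change R < |z|
      exact lt_abs.2 (Or.inr (by linarith))) hR
    have : u ≤ μ.real (Iic y) := hy
    rw [measureReal_def, h0] at this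
    exact absurd hu.1 (not_lt.2 (by simpa using this))
  have hmem : R ∈ {y : ℝ | u ≤ μ.real (Iic y)} := by
    have h0 : μ (Iic R)ᶜ = 0 := measure_mono_null (fun z hz => by
      change R < |z|
      exact lt_abs.2 (Or.inl (not_le.1 hz))) hR
    have h1 : μ (Iic R) = 1 := (prob_compl_eq_zero_iff measurableSet_Iic).1 h0
    change u ≤ μ.real (Iic R)
    rw [measureReal_def, h1]
    simpa using hu.2.le
  exact ⟨le_csInf ⟨R, hmem⟩ hlow, csInf_le ⟨-R, hlow⟩ hmem⟩

theorem isCompact_support_of_measure_lt_abs_eq_zero {μ : Measure ℝ} {R : ℝ}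
    (hR : μ {y | R < |y|} = 0) : IsCompact μ.support := by
  refine (isCompact_closedBall (0 : ℝ) R).of_isClosed_subset Measure.isClosed_support ?_
  refine Measure.support_subset_of_isClosed Metric.isClosed_closedBall ?_
  rw [mem_ae_iff]
  refine measure_mono_null (fun y hy => ?_) hR
  simpa using hy

end DetQuant

theorem proposition3 (μ : Measure ℝ) [IsProbabilityMeasure μ] (ρ : ℝ) (hρ : 1 < ρ)
    (h : ∃ α : ℝ, 1 / ρ < α ∧
      (⨆ (N : ℕ) (_ : 1 ≤ N), (N : ℝ≥0∞) ^ α * DetQuant.minError N μ ρ) < ∞) :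
    IsCompact μ.support ∧ DetQuant.quantileOne μ - DetQuant.quantileZeroPlus μ < ⊤ := by
  obtain ⟨R, hR⟩ := DetQuant.exists_measure_lt_abs_eq_zero (zero_lt_one.trans hρ) h
  refine ⟨DetQuant.isCompact_support_of_measure_lt_abs_eq_zero hR, ?_⟩
  have hone : DetQuant.quantileOne μ ≤ (R : EReal) := by
    refine le_of_tendsto (DetQuant.tendsto_quantileOne μ) ?_
    filter_upwards [Ioo_mem_nhdsLT (zero_lt_one' ℝ)] with u hu
    exact EReal.coe_le_coe_iff.2 (DetQuant.quantile_mem_Icc hR hu).2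
  have hzero : ((-R : ℝ) : EReal) ≤ DetQuant.quantileZeroPlus μ := by
    refine ge_of_tendsto (DetQuant.tendsto_quantileZeroPlus μ) ?_
    filter_upwards [Ioo_mem_nhdsGT (zero_lt_one' ℝ)] with u hu
    exact EReal.coe_le_coe_iff.2 (DetQuant.quantile_mem_Icc hR hu).1
  refine (EReal.sub_le_sub hone hzero).trans_lt ?_
  rw [← EReal.coe_sub]
  exact EReal.coe_lt_top _
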